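/- Let $d\ge 1$ and let $R$ be a real symmetric $d\times d$ matrix with $R_{ij}\ge 0$ for all $i,j$ and $\sum_i R_{ij}>0$ for each $j$. Fix initial weights $a_1,\dots,a_d>0$ and an initial state $y_0\in\{1,\dots,d\}$ (for instance all $a_i=1$ and $y_0=1$). Let $(Y_n)_{n\ge 0}$ be a vertex-reinforced random walk: random variables with values in $\{1,\dots,d\}$ such that $Y_0=y_0$ almost surely and, for all $n\ge 0$ and all $j$, $$\mathbf P(Y_{n+1}=j\mid \mathcal F_n)=\frac{R_{Y_n,j}\,S_j(n)}{\sum_i R_{Y_n,i}\,S_i(n)}\quad\text{almost surely},$$ where $\mathcal F_n=\sigma(Y_0,\dots,Y_n)$, $S_i(0)=a_i$ and $S_i(n+1)=S_i(n)+\mathbf 1\{Y_{n+1}=i\}$. Let $V(n)$ be the fractional occupation vector, $V_i(n)=S_i(n)/\sum_j S_j(n)$. For $v$ in the simplex $\triangle=\{v\in\mathbb R^d: v_i\ge 0,\ \sum_i v_i=1\}$ put $N_i(v)=\sum_j R_{ij}v_j$ and $H(v)=\sum_i v_iN_i(v)$, and, when $H(v)>0$, $\pi_i(v)=v_iN_i(v)/H(v)$.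 A critical point is a $v\in\triangle$ with $H(v)>0$ and $\pi(v)=v$. Suppose that all off-diagonal entries of $R$ are positive and that all principal minors of $R$ are invertible, i.e. for every nonempty $I\subseteq\{1,\dots,d\}$ the submatrix $(R_{ij})_{i,j\in I}$ is invertible. Then the set of critical points is finite, and almost surely $V(n)$ converges as $n\to\infty$ to a critical point. -/

import Mathlib

open MeasureTheory Filter Topology

namespace VRRW

noncomputable section

/-- `N_i(v) = ∑ j, R i j * v j`. -/
def N {d : ℕ} (R : Matrix (Fin d) (Fin d) ℝ) (v : Fin d → ℝ) (i : Fin d) : ℝ :=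
  ∑ j, R i j * v j

/-- `H(v) = ∑ i, v i * N_i(v)`, the quadratic form with matrix `R`. -/
def H {d : ℕ} (R : Matrix (Fin d) (Fin d) ℝ) (v : Fin d → ℝ) : ℝ :=
  ∑ i, v i * N R v i

/-- `π_i(v) = v i * N_i(v) / H(v)`, meaningful when `H(v) > 0`. -/
def piVec {d : ℕ} (R : Matrix (Fin d) (Fin d) ℝ) (v : Fin d → ℝ) (i : Fin d) : ℝ :=
  v i * N R v i / H R v

/-- The critical points: the points `v` of the simplex (with `H(v) > 0`, so that `π(v)` is
defined) such that `π(v) = v`. -/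
def criticalSet {d : ℕ} (R : Matrix (Fin d) (Fin d) ℝ) : Set (Fin d → ℝ) :=
  {v | v ∈ stdSimplex ℝ (Fin d) ∧ 0 < H R v ∧ piVec R v = v}

/-- The weights `S(n)`: initially `a`, and each later step `n + 1` adds one to the weight of the
state `Y (n + 1)`. -/
def S {d : ℕ} {Ω : Type*} (a : Fin d → ℝ) (Y : ℕ → Ω → Fin d) : ℕ → Ω → Fin d → ℝ
  | 0, _, i => a i
  | n + 1, ω, i => S a Y n ω i + if Y (n + 1) ω = i then 1 else 0

/-- The fractional occupation vector `V(n) = S(n) / ∑ j, S_j(n)`. -/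
def V {d : ℕ} {Ω : Type*} (a : Fin d → ℝ) (Y : ℕ → Ω → Fin d) (n : ℕ) (ω : Ω) (i : Fin d) : ℝ :=
  S a Y n ω i / ∑ j, S a Y n ω j

/-- The σ-field generated by `Y 0, …, Y n`. -/
abbrev history {d : ℕ} {Ω : Type*} (Y : ℕ → Ω → Fin d) (n : ℕ) : MeasurableSpace Ω :=
  ⨆ k ≤ n, MeasurableSpace.comap (Y k) inferInstance

/-- `Y` is a vertex-reinforced random walk on `Fin d` with likelihood matrix `R`, initial
weights `a` and initial state `y₀`. Time is counted from the starting time, so with `a = 1`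
the total weight at time `n` is `d + n`. -/
structure IsVRRW {d : ℕ} {Ω : Type*} [MeasurableSpace Ω] (μ : Measure Ω)
    (R : Matrix (Fin d) (Fin d) ℝ) (a : Fin d → ℝ) (y₀ : Fin d) (Y : ℕ → Ω → Fin d) : Prop where
  measurable : ∀ n, Measurable (Y n)
  initial : ∀ᵐ ω ∂μ, Y 0 ω = y₀
  /-- `P(Y_{n+1} = j | F_n) = R_{Y_n, j} S_j(n) / ∑ i, R_{Y_n, i} S_i(n)` almost surely. -/
  transition : ∀ (n : ℕ) (j : Fin d),
    μ[(Y (n + 1) ⁻¹' {j}).indicator (fun _ => (1 : ℝ)) | history Y n] =ᵐ[μ]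
      fun ω => R (Y n ω) j * S a Y n ω j / ∑ i, R (Y n ω) i * S a Y n ω i

end

end VRRW

/-!
The occupation vector follows the recursion `V(n+1) = V(n) + γ_n (e_{Y(n+1)} - V(n))`, where
`γ_n ~ 1/n`. If `V` were frozen at `v`, the walk would be a reversible Markov chain with stationary
distribution `π(v)`, so on average `V` is driven by the vector field `π(v) - v`.

The fluctuations `γ_n (e_{Y(n+1)} - π(V(n)))` form a convergent series. Solving Poisson's equation
for the frozen chain splits them into martingale differences, which are square summable, and
differences `w(V(n), Y(n)) - w(V(n), Y(n+1))` of a smooth function `w`, which telescope up to the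
slow variation of `V`.

Along the vector field the derivative of `H` is `2 / H(v)` times the variance of `N_i(v)` under the
weights `v_i`. Hence `H` is a Lyapunov function, strict off the critical points. It takes one value
for each support of a critical point, hence finitely many, which forces every cluster point of
`V(n)` to be critical. Finally, invertibility of the principal minors makes a critical point
determined by its support. The critical set is then finite, and as the steps of `V` tend to zero,
`V(n)` cannot oscillate between its points.
-/

namespace VRRW

/-! ### Cluster points of sequences with vanishing steps -/

section ClusterPoints

theorem eventually_of_frequently_of_eventually_imp_succ {p : ℕ → Prop}
    (hfreq : ∃ᶠ n in atTop, p n) (hsucc : ∀ᶠ n in atTop, p n → p (n + 1)) :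
    ∀ᶠ n in atTop, p n := by
  obtain ⟨n₀, hn₀⟩ := eventually_atTop.1 hsucc
  obtain ⟨n₁, hn₁, hp⟩ := frequently_atTop.1 hfreq n₀
  refine eventually_atTop.2 ⟨n₁, fun n hn => ?_⟩
  induction n, hn using Nat.le_induction with
  | base => exact hp
  | succ m hm ih => exact hn₀ m (hn₁.trans hm) ih

variable {E : Type*}

theorem tendsto_of_isolated_mapClusterPt [PseudoMetricSpace E] {K : Set E} (hK : IsCompact K)
    {x : ℕ → E} (hx : ∀ n, x n ∈ K)
    (hstep : Tendsto (fun n => dist (x (n + 1)) (x n)) atTop (𝓝 0)) {z : E}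
    (hz : MapClusterPt z atTop x) (hiso : ∀ᶠ w in 𝓝[≠] z, ¬MapClusterPt w atTop x) :
    Tendsto x atTop (𝓝 z) := by
  obtain ⟨ρ, hρ, hball⟩ := Metric.mem_nhdsWithin_iff.1 hiso
  refine Metric.tendsto_nhds.2 fun ε hε => ?_
  obtain ⟨r, hr, hrε, hrρ⟩ : ∃ r > 0, r ≤ ε ∧ 2 * r < ρ :=
    ⟨min ε (ρ / 3), by positivity, min_le_left _ _, by linarith [min_le_right ε (ρ / 3)]⟩
  have hannulus : IsCompact (K ∩ {w | r ≤ dist w z ∧ dist w z ≤ 2 * r}) := by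
    have hdist : Continuous fun w => dist w z := by fun_prop
    exact hK.inter_right
      ((isClosed_le continuous_const hdist).inter (isClosed_le hdist continuous_const))
  have havoid : ∀ᶠ n in atTop, x n ∉ K ∩ {w | r ≤ dist w z ∧ dist w z ≤ 2 * r} := by
    by_contra hfreq
    obtain ⟨w, ⟨-, hrw, hwr⟩, hw⟩ :=
      hannulus.exists_mapClusterPt_of_frequently
        ((not_eventually.1 hfreq).mono fun _ => not_not.1)
    refine hball ⟨hwr.trans_lt hrρ, ?_⟩ hw
    rintro rfl
    exact hrw.not_gt (by simpa using hr)
  refine (eventually_of_frequently_of_eventually_imp_succ (p := fun n => dist (x n) z < r)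
    (hz.frequently (Metric.ball_mem_nhds z hr)) ?_).mono fun n hn => hn.trans_le hrε
  filter_upwards [(tendsto_add_atTop_nat 1).eventually havoid, hstep.eventually_lt_const hr]
    with n hn hstep_lt hlt
  by_contra! hge
  exact hn ⟨hx _, hge, by linarith [dist_triangle (x (n + 1)) (x n) z]⟩

theorem exists_tendsto_of_finite_mapClusterPt [MetricSpace E] {K Z : Set E} (hK : IsCompact K)
    (hZ : Z.Finite) {x : ℕ → E} (hx : ∀ n, x n ∈ K)
    (hstep : Tendsto (fun n => dist (x (n + 1)) (x n)) atTop (𝓝 0))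
    (hcluster : ∀ p, MapClusterPt p atTop x → p ∈ Z) : ∃ z ∈ Z, Tendsto x atTop (𝓝 z) := by
  obtain ⟨z, -, hz⟩ := hK.exists_mapClusterPt_of_frequently
    (Frequently.of_forall (f := atTop) hx)
  refine ⟨z, hcluster z hz, tendsto_of_isolated_mapClusterPt hK hx hstep hz ?_⟩
  have hisolated : (Z \ {z})ᶜ ∈ 𝓝 z :=
    (hZ.subset Set.sdiff_subset).isClosed.isOpen_compl.mem_nhds (by simp)
  filter_upwards [mem_nhdsWithin_of_mem_nhds hisolated, self_mem_nhdsWithin] with w hw hwz hwx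
  exact hw ⟨hcluster w hwx, hwz⟩

/-- The lengths of the steps near `p` sum to at most the remaining increase of `h`, which is too
small for the sequence to leave a ball around `p`. -/
theorem tendsto_of_mapClusterPt_of_dist_succ_le_sub [PseudoMetricSpace E] {y : ℕ → E} {h : ℕ → ℝ}
    {l r : ℝ} {p : E} (hh : Tendsto h atTop (𝓝 l)) (hp : MapClusterPt p atTop y) (hr : 0 < r)
    (hdist : ∀ᶠ n in atTop, dist (y n) p < r → dist (y (n + 1)) (y n) ≤ h (n + 1) - h n) :
    Tendsto y atTop (𝓝 p) := by
  refine Metric.tendsto_atTop.2 fun ε hε => ?_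
  obtain ⟨δ, hδ, hδε, hδr⟩ : ∃ δ > 0, δ ≤ ε ∧ δ ≤ r :=
    ⟨min ε r, by positivity, min_le_left _ _, min_le_right _ _⟩
  obtain ⟨n₀, hn₀⟩ := eventually_atTop.1
    (hdist.and (Metric.tendsto_nhds.1 hh (δ / 4) (by positivity)))
  obtain ⟨n₁, hn₁, hstart⟩ := frequently_atTop.1
    (hp.frequently (Metric.ball_mem_nhds p (by positivity : 0 < δ / 4))) n₀
  have hclose : ∀ m ≥ n₁, dist (y m) (y n₁) ≤ h m - h n₁ → dist (y m) p < δ := by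
    intro m hm hle
    have hm_near := abs_lt.1 (hn₀ m (hn₁.trans hm)).2
    have hn_near := abs_lt.1 (hn₀ n₁ hn₁).2
    linarith [dist_triangle (y m) (y n₁) p, Metric.mem_ball.1 hstart]
  have hlength : ∀ m ≥ n₁, dist (y m) (y n₁) ≤ h m - h n₁ := by
    intro m hm
    induction m, hm using Nat.le_induction with
    | base => simp
    | succ m hm ih =>
      have hstep := (hn₀ m (hn₁.trans hm)).1 ((hclose m hm ih).trans_le hδr)
      linarith [dist_triangle (y (m + 1)) (y m) (y n₁)]
  exact ⟨n₁, fun m hm => (hclose m hm (hlength m hm)).trans_le hδε⟩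

theorem mapClusterPt_of_tendsto_dist [PseudoMetricSpace E] {x y : ℕ → E} {p : E}
    (hx : MapClusterPt p atTop x) (hxy : Tendsto (fun n => dist (x n) (y n)) atTop (𝓝 0)) :
    MapClusterPt p atTop y := by
  refine mapClusterPt_iff_frequently.2 fun s hs => ?_
  obtain ⟨ε, hε, hball⟩ := Metric.mem_nhds_iff.1 hs
  refine ((hx.frequently (Metric.ball_mem_nhds p (half_pos hε))).and_eventually
    (hxy.eventually_lt_const (half_pos hε))).mono fun n hn => hball ?_
  rw [Metric.mem_ball]
  linarith [dist_triangle_left (y n) p (x n), hn.1, hn.2]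

theorem tendsto_dist_comp_of_isCompact {F : Type*} [PseudoMetricSpace E] [PseudoMetricSpace F]
    {K : Set E} (hK : IsCompact K) {f : E → F} (hf : Continuous f) {x y : ℕ → E}
    (hx : ∀ n, x n ∈ K) (hxy : Tendsto (fun n => dist (x n) (y n)) atTop (𝓝 0)) :
    Tendsto (fun n => dist (f (x n)) (f (y n))) atTop (𝓝 0) := by
  have hpair := (tendsto_uniformity_iff_dist_tendsto_zero (f := fun n => (x n, y n))).2 hxy
  refine (tendsto_uniformity_iff_dist_tendsto_zero (f := fun n => (f (x n), f (y n)))).1 ?_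
  refine tendsto_def.2 fun V hV => ?_
  filter_upwards
    [hpair (hK.uniformContinuousAt_of_continuousAt f (fun _ _ => hf.continuousAt) hV)]
    with n hn using hn (hx n)

end ClusterPoints

/-! ### Approximate Lyapunov functions along a sequence -/

section Lyapunov

theorem tendsto_atTop_of_eventually_mul_le_sub {γ h : ℕ → ℝ} {η : ℝ} (hη : 0 < η)
    (hγ : Tendsto (fun n => ∑ k ∈ Finset.range n, γ k) atTop atTop)
    (hstep : ∀ᶠ n in atTop, γ n * η ≤ h (n + 1) - h n) : Tendsto h atTop atTop := by
  obtain ⟨n₀, hn₀⟩ := eventually_atTop.1 hstep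
  have hgrowth : ∀ m ≥ n₀,
      h n₀ + (∑ k ∈ Finset.range m, γ k - ∑ k ∈ Finset.range n₀, γ k) * η ≤ h m := by
    intro m hm
    induction m, hm using Nat.le_induction with
    | base => simp
    | succ m hm ih =>
      rw [Finset.sum_range_succ]
      linarith [hn₀ m hm]
  refine tendsto_atTop_mono' _ (eventually_atTop.2 ⟨n₀, hgrowth⟩) ?_
  exact tendsto_atTop_add_const_left _ _
    ((tendsto_atTop_add_const_right _ _ hγ).atTop_mul_const hη)

variable {E : Type*} {K : Set E} {L D : E → ℝ} {x : ℕ → E} {γ h ε : ℕ → ℝ}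

/-- On `K` the function `max |L - c| D` is positive, hence bounded below: close to the level `c`
the sequence `h` can only increase. -/
theorem eventually_sub_le_of_frequently_le [TopologicalSpace E] (hK : IsCompact K)
    (hL : ContinuousOn L K) (hD : ContinuousOn D K) (hD0 : ∀ p ∈ K, 0 ≤ D p) (hx : ∀ n, x n ∈ K)
    (hγ0 : ∀ n, 0 < γ n) (hγ : Tendsto γ atTop (𝓝 0))
    (hh : Tendsto (fun n => h n - L (x n)) atTop (𝓝 0)) (hε : Tendsto ε atTop (𝓝 0))
    (hstep : ∀ n, h (n + 1) = h n + γ n * (D (x n) + ε n)) {c r : ℝ}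
    (hc : ∀ p ∈ K, D p = 0 → L p ≠ c) (hfreq : ∃ᶠ n in atTop, c ≤ h n) (hr : 0 < r) :
    ∀ᶠ n in atTop, c - r ≤ h n := by
  obtain ⟨η, hη, hηK⟩ : ∃ η, 0 < η ∧ ∀ p ∈ K, η ≤ max |L p - c| (D p) := by
    refine hK.exists_forall_le' (by fun_prop) fun p hp => ?_
    by_contra! hle
    obtain ⟨hLc, hDp⟩ := max_le_iff.1 hle
    exact hc p hp (hDp.antisymm (hD0 p hp)) (sub_eq_zero.1 (abs_nonpos_iff.1 hLc))
  obtain ⟨δ, hδ, hδr, hδη⟩ : ∃ δ > 0, δ ≤ r ∧ 2 * δ < η :=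
    ⟨min r (η / 3), by positivity, min_le_left _ _, by linarith [min_le_right r (η / 3)]⟩
  have hγε : Tendsto (fun n => γ n * ε n) atTop (𝓝 0) := by simpa using hγ.mul hε
  refine (eventually_of_frequently_of_eventually_imp_succ (p := fun n => c - δ ≤ h n)
    (hfreq.mono fun n hn => by linarith) ?_).mono fun n hn => by linarith
  filter_upwards [Metric.tendsto_nhds.1 hh δ hδ, Metric.tendsto_nhds.1 hε η hη,
    Metric.tendsto_nhds.1 hγε δ hδ] with n hnear hεη hγεδ hn
  rw [dist_zero_right, Real.norm_eq_abs, abs_lt] at hnear hεη hγεδ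
  rw [hstep n]
  rcases le_total (h n) (c + δ) with hle | hge
  · have hlevel : |L (x n) - c| < η := abs_lt.2 ⟨by linarith, by linarith⟩
    have hηD : η ≤ D (x n) := (le_max_iff.1 (hηK _ (hx n))).resolve_left hlevel.not_ge
    have hincrease : 0 ≤ γ n * (D (x n) + ε n) := mul_nonneg (hγ0 n).le (by linarith)
    linarith
  · have hdrift : 0 ≤ γ n * D (x n) := mul_nonneg (hγ0 n).le (hD0 _ (hx n))
    linarith

theorem exists_tendsto_of_approx_lyapunov [TopologicalSpace E] (hK : IsCompact K)
    (hL : ContinuousOn L K) (hD : ContinuousOn D K) (hD0 : ∀ p ∈ K, 0 ≤ D p)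
    (hfin : (L '' {p ∈ K | D p = 0}).Finite) (hx : ∀ n, x n ∈ K)
    (hγ0 : ∀ n, 0 < γ n) (hγ : Tendsto γ atTop (𝓝 0))
    (hh : Tendsto (fun n => h n - L (x n)) atTop (𝓝 0)) (hε : Tendsto ε atTop (𝓝 0))
    (hstep : ∀ n, h (n + 1) = h n + γ n * (D (x n) + ε n)) :
    ∃ l, Tendsto h atTop (𝓝 l) := by
  obtain ⟨B, hB⟩ := hK.exists_bound_of_continuousOn hL
  have hbounded : ∀ᶠ n in atTop, |h n| ≤ B + 1 := by
    filter_upwards [Metric.tendsto_nhds.1 hh 1 one_pos] with n hn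
    rw [dist_zero_right, Real.norm_eq_abs] at hn
    have hLx := hB (x n) (hx n)
    rw [Real.norm_eq_abs] at hLx
    linarith [abs_sub_abs_le_abs_sub (h n) (L (x n))]
  refine tendsto_of_no_upcrossings (hfin.countable.dense_compl ℝ) ?_
    ⟨B + 1, eventually_map.2 (hbounded.mono fun n hn => (abs_le.1 hn).2)⟩
    ⟨-(B + 1), eventually_map.2 (hbounded.mono fun n hn => (abs_le.1 hn).1)⟩
  rintro a - c hc hac ⟨hbelow, habove⟩
  have hstay := eventually_sub_le_of_frequently_le hK hL hD hD0 hx hγ0 hγ hh hε hstep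
    (fun p hp hDp hLp => hc ⟨p, ⟨hp, hDp⟩, hLp⟩) (habove.mono fun _ => le_of_lt)
    (sub_pos.2 hac)
  obtain ⟨n, hlt, hle⟩ := (hbelow.and_eventually hstay).exists
  linarith

theorem nonpos_of_mapClusterPt_of_approx_lyapunov [PseudoMetricSpace E] (hD : ContinuousOn D K)
    (hx : ∀ n, x n ∈ K) (hγ0 : ∀ n, 0 < γ n)
    (hγ : Tendsto (fun n => ∑ k ∈ Finset.range n, γ k) atTop atTop) {l : ℝ}
    (hh : Tendsto h atTop (𝓝 l)) (hε : Tendsto ε atTop (𝓝 0))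
    (hstep : ∀ n, h (n + 1) = h n + γ n * (D (x n) + ε n)) {y : ℕ → E} {C : ℝ} (hC : 0 ≤ C)
    (hy : ∀ n, dist (y (n + 1)) (y n) ≤ C * γ n)
    (hxy : Tendsto (fun n => dist (x n) (y n)) atTop (𝓝 0)) {p : E} (hpK : p ∈ K)
    (hp : MapClusterPt p atTop x) : D p ≤ 0 := by
  by_contra! hpos
  obtain ⟨η, hη, hηD⟩ := exists_between hpos
  obtain ⟨r, hr, hball⟩ := Metric.mem_nhdsWithin_iff.1 ((hD p hpK).eventually_const_lt hηD)
  have hgain : ∀ᶠ n in atTop, dist (x n) p < r → γ n * (η / 2) ≤ h (n + 1) - h n := by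
    filter_upwards [Metric.tendsto_nhds.1 hε (η / 2) (half_pos hη)] with n hn hxp
    rw [dist_zero_right, Real.norm_eq_abs, abs_lt] at hn
    have hDx : η < D (x n) := hball ⟨hxp, hx n⟩
    rw [hstep n, add_sub_cancel_left]
    exact mul_le_mul_of_nonneg_left (by linarith) (hγ0 n).le
  have hyp : Tendsto y atTop (𝓝 p) := by
    refine tendsto_of_mapClusterPt_of_dist_succ_le_sub (hh.const_mul (C / (η / 2)))
      (mapClusterPt_of_tendsto_dist hp hxy) (half_pos hr) ?_
    filter_upwards [hgain, hxy.eventually_lt_const (half_pos hr)] with n hn hclose hyn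
    calc dist (y (n + 1)) (y n) ≤ C / (η / 2) * (γ n * (η / 2)) := by
          rw [div_mul_eq_mul_div, mul_div_assoc, mul_div_cancel_right₀ _ (half_pos hη).ne']
          exact hy n
      _ ≤ C / (η / 2) * (h (n + 1) - h n) := by
          gcongr
          exact hn (by linarith [dist_triangle (x n) (y n) p])
      _ = C / (η / 2) * h (n + 1) - C / (η / 2) * h n := mul_sub _ _ _
  have hxp : Tendsto x atTop (𝓝 p) := (tendsto_iff_of_dist hxy).2 hyp
  refine not_tendsto_nhds_of_tendsto_atTop ?_ l hh
  refine tendsto_atTop_of_eventually_mul_le_sub (half_pos hη) hγ ?_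
  filter_upwards [hgain, Metric.tendsto_nhds.1 hxp r hr] with n hn hxn using hn hxn

end Lyapunov

/-! ### Robbins–Monro recursions with a strict Lyapunov function -/

/-- The sequence `x` follows the recursion `x (n + 1) = x n + γ n • F (x n) + e n`, where the step
sizes `γ n > 0` tend to zero and have infinite sum and the series of the noise terms `e n`
converges. The noise is not recorded: it is recovered as `x (n + 1) - x n - γ n • F (x n)`. -/
structure IsRobbinsMonro {E : Type*} [NormedAddCommGroup E] [NormedSpace ℝ E] (F : E → E)
    (γ : ℕ → ℝ) (x : ℕ → E) : Prop where
  step_pos : ∀ n, 0 < γ n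
  tendsto_step : Tendsto γ atTop (𝓝 0)
  tendsto_sum_step : Tendsto (fun n => ∑ k ∈ Finset.range n, γ k) atTop atTop
  exists_tendsto_noise : ∃ c,
    Tendsto (fun n => ∑ k ∈ Finset.range n, (x (k + 1) - x k - γ k • F (x k))) atTop (𝓝 c)

namespace IsRobbinsMonro

variable {E : Type*} [NormedAddCommGroup E] [NormedSpace ℝ E] {F : E → E} {γ : ℕ → ℝ}
  {x : ℕ → E} {K : Set E}

theorem exists_noiseless_recursion (h : IsRobbinsMonro F γ x) :
    ∃ y : ℕ → E, (∀ n, y (n + 1) = y n + γ n • F (x n)) ∧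
      Tendsto (fun n => dist (x n) (y n)) atTop (𝓝 0) := by
  obtain ⟨c, hc⟩ := h.exists_tendsto_noise
  refine ⟨fun n => x n + (c - ∑ k ∈ Finset.range n, (x (k + 1) - x k - γ k • F (x k))),
    fun n => ?_, ?_⟩
  · simp only [Finset.sum_range_succ]
    abel
  · simpa using (hc.const_sub c).norm

theorem tendsto_smul_comp (h : IsRobbinsMonro F γ x) (hK : IsCompact K) (hF : ContinuousOn F K)
    (hx : ∀ n, x n ∈ K) : Tendsto (fun n => γ n • F (x n)) atTop (𝓝 0) := by
  obtain ⟨C, hC⟩ := hK.exists_bound_of_continuousOn hF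
  exact h.tendsto_step.zero_smul_isBoundedUnder_le
    (isBoundedUnder_of ⟨C, fun n => hC _ (hx n)⟩)

theorem tendsto_dist_succ (h : IsRobbinsMonro F γ x) (hK : IsCompact K) (hF : ContinuousOn F K)
    (hx : ∀ n, x n ∈ K) : Tendsto (fun n => dist (x (n + 1)) (x n)) atTop (𝓝 0) := by
  obtain ⟨c, hc⟩ := h.exists_tendsto_noise
  have hnoise : Tendsto (fun n => x (n + 1) - x n - γ n • F (x n)) atTop (𝓝 0) := by
    simpa only [Function.comp_def, Finset.sum_range_succ, add_sub_cancel_left, sub_self] using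
      (hc.comp (tendsto_add_atTop_nat 1)).sub hc
  simpa [dist_eq_norm] using (hnoise.add (h.tendsto_smul_comp hK hF hx)).norm

theorem exists_lyapunov_increment (h : IsRobbinsMonro F γ x) (hK : IsCompact K)
    (hF : ContinuousOn F K) (hx : ∀ n, x n ∈ K) {L : E → ℝ} (hL : ContDiff ℝ 1 L) {y : ℕ → E}
    (hy : ∀ n, y (n + 1) = y n + γ n • F (x n))
    (hxy : Tendsto (fun n => dist (x n) (y n)) atTop (𝓝 0)) :
    ∃ ε : ℕ → ℝ, Tendsto ε atTop (𝓝 0) ∧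
      ∀ n, L (y (n + 1)) = L (y n) + γ n * (fderiv ℝ L (x n) (F (x n)) + ε n) := by
  have hmvt : ∀ n, ∃ ξ ∈ segment ℝ (y n) (y (n + 1)),
      L (y (n + 1)) - L (y n) = fderiv ℝ L ξ (y (n + 1) - y n) := fun n =>
    domain_mvt (fun p _ => (hL.differentiable one_ne_zero p).hasFDerivAt.hasFDerivWithinAt)
      convex_univ (Set.mem_univ _) (Set.mem_univ _)
  choose ξ hξ hLξ using hmvt
  have hxξ : Tendsto (fun n => dist (x n) (ξ n)) atTop (𝓝 0) := by
    have hbound : Tendsto (fun n => dist (x n) (y n) + ‖γ n • F (x n)‖) atTop (𝓝 0) := by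
      simpa using hxy.add (h.tendsto_smul_comp hK hF hx).norm
    refine squeeze_zero (fun _ => dist_nonneg) (fun n => ?_) hbound
    refine (dist_triangle _ (y n) _).trans (add_le_add_right ?_ _)
    have hle := dist_add_dist_of_mem_segment (hξ n)
    rw [hy n, dist_self_add_right] at hle
    linarith [dist_nonneg (x := ξ n) (y := y n + γ n • F (x n))]
  obtain ⟨C, hC⟩ := hK.exists_bound_of_continuousOn hF
  refine ⟨fun n => (fderiv ℝ L (ξ n) - fderiv ℝ L (x n)) (F (x n)), ?_, fun n => ?_⟩
  · have hderiv := tendsto_dist_comp_of_isCompact hK (hL.continuous_fderiv one_ne_zero) hx hxξ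
    refine squeeze_zero_norm (fun n => ?_) (by simpa using hderiv.mul_const C)
    rw [dist_comm, dist_eq_norm]
    exact (ContinuousLinearMap.le_opNorm _ _).trans
      (mul_le_mul_of_nonneg_left (hC _ (hx n)) (norm_nonneg _))
  · have hincrement := hLξ n
    rw [hy n, add_sub_cancel_left, map_smul, smul_eq_mul, ← hy n] at hincrement
    simp only [sub_apply, add_sub_cancel]
    rw [← hincrement, add_sub_cancel]

theorem fderiv_apply_eq_zero_of_mapClusterPt (h : IsRobbinsMonro F γ x) (hK : IsCompact K)
    (hF : ContinuousOn F K) (hx : ∀ n, x n ∈ K) {L : E → ℝ} (hL : ContDiff ℝ 1 L)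
    (hnonneg : ∀ p ∈ K, 0 ≤ fderiv ℝ L p (F p))
    (hfin : (L '' {p ∈ K | fderiv ℝ L p (F p) = 0}).Finite) {p : E} (hpK : p ∈ K)
    (hp : MapClusterPt p atTop x) : fderiv ℝ L p (F p) = 0 := by
  obtain ⟨y, hy, hxy⟩ := h.exists_noiseless_recursion
  obtain ⟨ε, hε, hstep⟩ := h.exists_lyapunov_increment hK hF hx hL hy hxy
  have hD : ContinuousOn (fun p => fderiv ℝ L p (F p)) K :=
    (hL.continuous_fderiv one_ne_zero).continuousOn.clm_apply hF
  have hLxy : Tendsto (fun n => L (y n) - L (x n)) atTop (𝓝 0) := by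
    refine tendsto_zero_iff_norm_tendsto_zero.2 ?_
    simpa only [← dist_eq_norm, dist_comm] using
      tendsto_dist_comp_of_isCompact hK hL.continuous hx hxy
  obtain ⟨l, hl⟩ := exists_tendsto_of_approx_lyapunov hK hL.continuous.continuousOn hD hnonneg
    hfin hx h.step_pos h.tendsto_step hLxy hε hstep
  obtain ⟨C, hC⟩ := hK.exists_bound_of_continuousOn hF
  have hystep : ∀ n, dist (y (n + 1)) (y n) ≤ C * γ n := fun n => by
    rw [hy, dist_self_add_left, norm_smul, Real.norm_of_nonneg (h.step_pos n).le, mul_comm]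
    exact mul_le_mul_of_nonneg_right (hC _ (hx n)) (h.step_pos n).le
  refine le_antisymm ?_ (hnonneg p hpK)
  exact nonpos_of_mapClusterPt_of_approx_lyapunov hD hx h.step_pos h.tendsto_sum_step hl hε hstep
    ((norm_nonneg _).trans (hC p hpK)) hystep hxy hpK hp

end IsRobbinsMonro

/-! ### Critical points -/

section CriticalPoints

open scoped Matrix

theorem eq_zero_of_isUnit_submatrix {ι α : Type*} [Fintype ι] [DecidableEq ι] [CommRing α]
    {A : Matrix ι ι α} {s : Finset ι}
    (hs : IsUnit (A.submatrix (fun i : s => (i : ι)) (fun i : s => (i : ι)))) {u : ι → α}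
    (hu : ∀ i ∉ s, u i = 0) (hAu : ∀ i ∈ s, (A *ᵥ u) i = 0) : u = 0 := by
  have hrestrict : (fun i : s => u i) = 0 := by
    refine Matrix.mulVec_injective_of_isUnit hs ?_
    ext i
    calc ∑ j : s, A i j * u j = ∑ j ∈ s, A i j * u j := Finset.sum_coe_sort s fun j => A i j * u j
      _ = (A *ᵥ u) i := Finset.sum_subset s.subset_univ fun j _ hj => by rw [hu j hj, mul_zero]
      _ = _ := by rw [hAu i i.2, Matrix.mulVec_zero, Pi.zero_apply]
  ext i
  by_cases hi : i ∈ s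
  exacts [congrFun hrestrict ⟨i, hi⟩, hu i hi]

theorem exists_pos_of_mem_stdSimplex {ι : Type*} [Fintype ι] {v : ι → ℝ}
    (hv : v ∈ stdSimplex ℝ ι) : ∃ i, 0 < v i := by
  by_contra! hle
  exact one_pos.not_ge (hv.2 ▸ Finset.sum_nonpos fun i _ => hle i)

theorem sum_mul_pos_of_mem_stdSimplex {ι : Type*} [Fintype ι] {v f : ι → ℝ}
    (hv : v ∈ stdSimplex ℝ ι) (hf : ∀ i, 0 < f i) : 0 < ∑ i, v i * f i := by
  obtain ⟨i, hi⟩ := exists_pos_of_mem_stdSimplex hv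
  exact Finset.sum_pos' (fun j _ => mul_nonneg (hv.1 j) (hf j).le)
    ⟨i, Finset.mem_univ i, mul_pos hi (hf i)⟩

variable {d : ℕ} {R : Matrix (Fin d) (Fin d) ℝ} {v w : Fin d → ℝ}

theorem pos_of_isUnit_submatrix (hnonneg : ∀ i j, 0 ≤ R i j) (hoff : ∀ i j, i ≠ j → 0 < R i j)
    (hminors : ∀ s : Finset (Fin d), s.Nonempty →
      IsUnit (R.submatrix (fun i : s => (i : Fin d)) (fun i : s => (i : Fin d))))
    (i j : Fin d) : 0 < R i j := by
  rcases eq_or_ne i j with rfl | hij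
  · refine (hnonneg i i).lt_of_ne' fun hzero => one_ne_zero (α := ℝ) ?_
    have hsingle := eq_zero_of_isUnit_submatrix (hminors {i} (Finset.singleton_nonempty i))
      (u := Pi.single i 1) (fun j hj => Pi.single_eq_of_ne (by simpa using hj) 1)
      (by simpa using hzero)
    simpa using congrFun hsingle i
  · exact hoff i j hij

theorem N_pos (hpos : ∀ i j, 0 < R i j) (hv : v ∈ stdSimplex ℝ (Fin d)) (i : Fin d) :
    0 < N R v i := by
  simpa only [N, mul_comm] using sum_mul_pos_of_mem_stdSimplex hv (hpos i)

theorem H_pos (hpos : ∀ i j, 0 < R i j) (hv : v ∈ stdSimplex ℝ (Fin d)) : 0 < H R v :=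
  sum_mul_pos_of_mem_stdSimplex hv (N_pos hpos hv)

theorem dotProduct_N_comm (hsymm : R.IsSymm) (v w : Fin d → ℝ) :
    v ⬝ᵥ N R w = w ⬝ᵥ N R v :=
  calc v ⬝ᵥ R *ᵥ w = w ⬝ᵥ v ᵥ* R := by rw [Matrix.dotProduct_mulVec, dotProduct_comm]
    _ = w ⬝ᵥ R *ᵥ v := by rw [← Matrix.mulVec_transpose, hsymm.eq]

theorem N_eq_H_of_mem_criticalSet (hv : v ∈ criticalSet R) {i : Fin d} (hi : v i ≠ 0) :
    N R v i = H R v := by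
  obtain ⟨-, hH, hpi⟩ := hv
  have hpi_i := congrFun hpi i
  rw [piVec, div_eq_iff hH.ne'] at hpi_i
  exact mul_left_cancel₀ hi hpi_i

theorem dotProduct_N_eq_H (hv : v ∈ criticalSet R) (hw : w ∈ stdSimplex ℝ (Fin d))
    (hsupp : Function.support w ⊆ Function.support v) : w ⬝ᵥ N R v = H R v :=
  calc ∑ i, w i * N R v i = ∑ i, w i * H R v := Finset.sum_congr rfl fun i _ => by
        by_cases hi : w i = 0
        · simp only [hi, zero_mul]
        · rw [N_eq_H_of_mem_criticalSet hv (hsupp hi)]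
    _ = H R v := by rw [← Finset.sum_mul, hw.2, one_mul]

theorem H_eq_of_support_eq (hsymm : R.IsSymm) (hv : v ∈ criticalSet R) (hw : w ∈ criticalSet R)
    (hsupp : Function.support v = Function.support w) : H R v = H R w := by
  rw [← dotProduct_N_eq_H hv hw.1 hsupp.ge, dotProduct_N_comm hsymm,
    dotProduct_N_eq_H hw hv.1 hsupp.le]

theorem finite_image_H_criticalSet (hsymm : R.IsSymm) : (H R '' criticalSet R).Finite := by
  refine (Set.finite_iUnion fun s : Set (Fin d) =>
    Set.Subsingleton.finite (s := H R '' {v ∈ criticalSet R | Function.support v = s}) ?_).subset ?_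
  · rintro _ ⟨v, ⟨hv, rfl⟩, rfl⟩ _ ⟨w, ⟨hw, hsupp⟩, rfl⟩
    exact H_eq_of_support_eq hsymm hv hw hsupp.symm
  · rintro _ ⟨v, hv, rfl⟩
    exact Set.mem_iUnion.2 ⟨_, v, ⟨hv, rfl⟩, rfl⟩

theorem injOn_support_criticalSet
    (hminors : ∀ s : Finset (Fin d), s.Nonempty →
      IsUnit (R.submatrix (fun i : s => (i : Fin d)) (fun i : s => (i : Fin d)))) :
    Set.InjOn Function.support (criticalSet R) := by
  intro v hv w hw hsupp
  have hmem : ∀ i, i ∈ Finset.univ.filter (v · ≠ 0) ↔ v i ≠ 0 := fun i => by simp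
  have hzero : ∀ i, v i = 0 ↔ w i = 0 := fun i => not_iff_not.1 (Set.ext_iff.1 hsupp i)
  obtain ⟨i₀, hi₀⟩ := exists_pos_of_mem_stdSimplex hv.1
  have hcomb : H R w • v - H R v • w = 0 := by
    refine eq_zero_of_isUnit_submatrix (hminors _ ⟨i₀, (hmem i₀).2 hi₀.ne'⟩) ?_ ?_
    · intro i hi
      have hvi : v i = 0 := not_not.1 (mt (hmem i).2 hi)
      simp [hvi, (hzero i).1 hvi]
    · intro i hi
      have hvi : v i ≠ 0 := (hmem i).1 hi
      rw [Matrix.mulVec_sub, Matrix.mulVec_smul, Matrix.mulVec_smul]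
      change H R w * N R v i - H R v * N R w i = 0
      rw [N_eq_H_of_mem_criticalSet hv hvi, N_eq_H_of_mem_criticalSet hw (mt (hzero i).2 hvi)]
      ring
  have hH : H R w = H R v := by
    have hsum := congrArg (fun u => ∑ i, u i) (sub_eq_zero.1 hcomb)
    simpa [← Finset.mul_sum, hv.1.2, hw.1.2] using hsum
  rw [hH, ← smul_sub, smul_eq_zero, sub_eq_zero] at hcomb
  exact hcomb.resolve_left hv.2.1.ne'

theorem finite_criticalSet
    (hminors : ∀ s : Finset (Fin d), s.Nonempty →
      IsUnit (R.submatrix (fun i : s => (i : Fin d)) (fun i : s => (i : Fin d)))) :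
    (criticalSet R).Finite :=
  .of_finite_image (Set.toFinite _) (injOn_support_criticalSet hminors)

end CriticalPoints

/-! ### The Lyapunov function `H` -/

section LyapunovFunction

variable {d : ℕ} {R : Matrix (Fin d) (Fin d) ℝ} {v : Fin d → ℝ}

/-- The vector field `π(v) - v` of the mean-field equation that the occupation vector follows. -/
noncomputable def drift (R : Matrix (Fin d) (Fin d) ℝ) (v : Fin d → ℝ) : Fin d → ℝ :=
  piVec R v - v

theorem contDiff_H : ContDiff ℝ 1 (H R) := by
  unfold H N
  fun_prop

theorem contDiffOn_piVec (hpos : ∀ i j, 0 < R i j) :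
    ContDiffOn ℝ 1 (piVec R) (stdSimplex ℝ (Fin d)) := by
  refine contDiffOn_pi.2 fun i => ?_
  have hN : ContDiff ℝ 1 fun v => v i * N R v i := by
    unfold N
    fun_prop
  exact hN.contDiffOn.div contDiff_H.contDiffOn fun v hv => (H_pos hpos hv).ne'

theorem continuousOn_drift (hpos : ∀ i j, 0 < R i j) :
    ContinuousOn (drift R) (stdSimplex ℝ (Fin d)) :=
  (contDiffOn_piVec hpos).continuousOn.sub continuousOn_id

theorem fderiv_H_apply (hsymm : R.IsSymm) (v u : Fin d → ℝ) :
    fderiv ℝ (H R) v u = 2 * u ⬝ᵥ N R v := by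
  have hcoord : ∀ i, HasFDerivAt (fun w : Fin d → ℝ => w i) (.proj (R := ℝ) i) v :=
    fun i => hasFDerivAt_apply i v
  have hderiv : HasFDerivAt (H R) _ v := .fun_sum fun i _ =>
    (hcoord i).mul (.fun_sum fun j _ => (hcoord j).const_mul (R i j))
  calc fderiv ℝ (H R) v u = v ⬝ᵥ N R u + u ⬝ᵥ N R v := by
        rw [hderiv.fderiv]
        simp [N, dotProduct, Finset.sum_add_distrib, mul_comm]
    _ = 2 * u ⬝ᵥ N R v := by rw [dotProduct_N_comm hsymm, two_mul]

theorem fderiv_H_drift (hsymm : R.IsSymm) (hv : v ∈ stdSimplex ℝ (Fin d)) (hH : H R v ≠ 0) :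
    fderiv ℝ (H R) v (drift R v) = 2 / H R v * ∑ i, v i * (N R v i - H R v) ^ 2 := by
  have hmean : ∑ i, v i * (N R v i - H R v) = 0 := by
    simp only [mul_sub, Finset.sum_sub_distrib, ← Finset.sum_mul, hv.2, one_mul]
    exact sub_self (H R v)
  have hvariance : ∑ i, v i * (N R v i - H R v) ^ 2 = ∑ i, v i * (N R v i - H R v) * N R v i :=
    calc ∑ i, v i * (N R v i - H R v) ^ 2
        = ∑ i, (v i * (N R v i - H R v) * N R v i - v i * (N R v i - H R v) * H R v) :=
          Finset.sum_congr rfl fun i _ => by ring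
      _ = _ := by rw [Finset.sum_sub_distrib, ← Finset.sum_mul, hmean, zero_mul, sub_zero]
  rw [fderiv_H_apply hsymm, hvariance, div_mul_eq_mul_div, mul_div_assoc, Finset.sum_div]
  congr 1
  refine Finset.sum_congr rfl fun i _ => ?_
  simp only [drift, piVec, Pi.sub_apply]
  field_simp

theorem fderiv_H_drift_nonneg (hsymm : R.IsSymm) (hpos : ∀ i j, 0 < R i j)
    (hv : v ∈ stdSimplex ℝ (Fin d)) : 0 ≤ fderiv ℝ (H R) v (drift R v) := by
  have hH := H_pos hpos hv
  rw [fderiv_H_drift hsymm hv hH.ne']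
  exact mul_nonneg (by positivity)
    (Finset.sum_nonneg fun i _ => mul_nonneg (hv.1 i) (sq_nonneg _))

theorem mem_criticalSet_of_fderiv_H_drift_eq_zero (hsymm : R.IsSymm) (hpos : ∀ i j, 0 < R i j)
    (hv : v ∈ stdSimplex ℝ (Fin d)) (hzero : fderiv ℝ (H R) v (drift R v) = 0) :
    v ∈ criticalSet R := by
  have hH := H_pos hpos hv
  rw [fderiv_H_drift hsymm hv hH.ne', mul_eq_zero_iff_left (by positivity),
    Finset.sum_eq_zero_iff_of_nonneg fun i _ => mul_nonneg (hv.1 i) (sq_nonneg _)] at hzero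
  refine ⟨hv, hH, funext fun i => (div_eq_iff hH.ne').2 ?_⟩
  rcases mul_eq_zero.1 (hzero i (Finset.mem_univ i)) with hvi | hNi
  · rw [hvi, zero_mul, zero_mul]
  · rw [sub_eq_zero.1 (pow_eq_zero_iff two_ne_zero |>.1 hNi)]

end LyapunovFunction

/-! ### Poisson's equation for a finite Markov chain -/

section Poisson

open scoped Matrix

variable {ι : Type*} [Fintype ι] [DecidableEq ι]

theorem le_of_mulVec_eq_self {P : Matrix ι ι ℝ} (hP : P ∈ Matrix.rowStochastic ℝ ι) {j : ι}
    (hcol : ∀ i, 0 < P i j) {f : ι → ℝ} (hf : P *ᵥ f = f) (i : ι) : f i ≤ f j := by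
  have : Nonempty ι := ⟨i⟩
  obtain ⟨m, hm⟩ := Finite.exists_max f
  have hgap : ∑ k, P m k * (f m - f k) = 0 := by
    simp only [mul_sub, Finset.sum_sub_distrib, ← Finset.sum_mul,
      Matrix.sum_row_of_mem_rowStochastic hP, one_mul]
    exact sub_eq_zero.2 (congrFun hf m).symm
  have hgap_j := (Finset.sum_eq_zero_iff_of_nonneg fun k _ =>
    mul_nonneg (Matrix.nonneg_of_mem_rowStochastic hP) (sub_nonneg.2 (hm k))).1 hgap j
      (Finset.mem_univ j)
  have hmj : f m = f j := sub_eq_zero.1 ((mul_eq_zero.1 hgap_j).resolve_left (hcol m).ne')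
  exact hmj ▸ hm i

theorem eq_of_mulVec_eq_self {P : Matrix ι ι ℝ} (hP : P ∈ Matrix.rowStochastic ℝ ι) {j : ι}
    (hcol : ∀ i, 0 < P i j) {f : ι → ℝ} (hf : P *ᵥ f = f) (i : ι) : f i = f j :=
  (le_of_mulVec_eq_self hP hcol hf i).antisymm <| neg_le_neg_iff.1 <|
    le_of_mulVec_eq_self (f := -f) hP hcol (by rw [Matrix.mulVec_neg, hf]) i

variable {𝕜 : Type*} [Field 𝕜] {P : Matrix ι ι 𝕜} {π : ι → 𝕜}

/-- Kemeny and Snell's fundamental matrix `(1 - P + Π)⁻¹` of a Markov chain with transition matrix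
`P` and stationary distribution `π`, where all rows of `Π` are `π`. It inverts `1 - P` on the
functions of mean zero. -/
noncomputable def fundamentalMatrix (P : Matrix ι ι 𝕜) (π : ι → 𝕜) : Matrix ι ι 𝕜 :=
  (1 - P + Matrix.of fun _ => π)⁻¹

theorem isUnit_one_sub_add_of_stationary (hπ : π ᵥ* P = π) (hπ1 : ∑ i, π i = 1) {j : ι}
    (hharmonic : ∀ f : ι → 𝕜, P *ᵥ f = f → ∀ i, f i = f j) :
    IsUnit (1 - P + Matrix.of fun _ => π) := by
  refine Matrix.mulVec_injective_iff_isUnit.1 ((injective_iff_map_eq_zero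
    (Matrix.mulVecLin (1 - P + Matrix.of fun _ => π))).2 fun f hf => ?_)
  have hpointwise : f - P *ᵥ f + (fun _ => π ⬝ᵥ f) = 0 := by
    rwa [Matrix.mulVecLin_apply, Matrix.add_mulVec, Matrix.sub_mulVec, Matrix.one_mulVec] at hf
  have hmean : π ⬝ᵥ f = 0 := by
    have hdot := congrArg (π ⬝ᵥ ·) hpointwise
    rwa [dotProduct_add, dotProduct_sub, Matrix.dotProduct_mulVec, hπ, sub_self, zero_add,
      dotProduct_zero, dotProduct, ← Finset.sum_mul, hπ1, one_mul] at hdot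
  have hconst : ∀ i, f i = f j := hharmonic f <| by
    rw [hmean] at hpointwise
    exact (sub_eq_zero.1 ((add_zero _).symm.trans hpointwise)).symm
  have hfj : f j = 0 := by
    rw [← hmean, dotProduct, ← one_mul (f j), ← hπ1, Finset.sum_mul]
    exact Finset.sum_congr rfl fun i _ => by rw [hconst i]
  ext i
  rw [hconst i, hfj, Pi.zero_apply]

theorem sub_mulVec_fundamentalMatrix_mulVec (hπ : π ᵥ* P = π) (hπ1 : ∑ i, π i = 1)
    (hunit : IsUnit (1 - P + Matrix.of fun _ => π)) (f : ι → 𝕜) :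
    fundamentalMatrix P π *ᵥ f - P *ᵥ fundamentalMatrix P π *ᵥ f = f - fun _ => π ⬝ᵥ f := by
  have hdet := (Matrix.isUnit_iff_isUnit_det _).1 hunit
  have hrow : π ᵥ* (1 - P + Matrix.of fun _ => π) = π := by
    rw [Matrix.vecMul_add, Matrix.vecMul_sub, Matrix.vecMul_one, hπ, sub_self, zero_add]
    ext i
    change ∑ k, π k * π i = π i
    rw [← Finset.sum_mul, hπ1, one_mul]
  have hπZ : π ᵥ* fundamentalMatrix P π = π :=
    calc π ᵥ* fundamentalMatrix P π
        = (π ᵥ* (1 - P + Matrix.of fun _ => π)) ᵥ* fundamentalMatrix P π := by rw [hrow]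
      _ = π := by
        rw [fundamentalMatrix, Matrix.vecMul_vecMul, Matrix.mul_nonsing_inv _ hdet,
          Matrix.vecMul_one]
  have hsolve : (1 - P + Matrix.of fun _ => π) *ᵥ fundamentalMatrix P π *ᵥ f = f := by
    rw [fundamentalMatrix, Matrix.mulVec_mulVec, Matrix.mul_nonsing_inv _ hdet, Matrix.one_mulVec]
  rw [Matrix.add_mulVec, Matrix.sub_mulVec, Matrix.one_mulVec] at hsolve
  refine eq_sub_of_add_eq (Eq.trans (congrArg _ (funext fun _ => ?_)) hsolve)
  change π ⬝ᵥ f = π ⬝ᵥ fundamentalMatrix P π *ᵥ f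
  rw [Matrix.dotProduct_mulVec, hπZ]

end Poisson

/-! ### Smoothness of the inverse matrix -/

section MatrixSmoothness

variable {𝕜 E ι : Type*} [NontriviallyNormedField 𝕜] [NormedAddCommGroup E] [NormedSpace 𝕜 E]
  [Fintype ι] [DecidableEq ι] {n : WithTop ℕ∞} {s : Set E} {A : E → Matrix ι ι 𝕜}

theorem contDiffOn_det (hA : ∀ i j, ContDiffOn 𝕜 n (fun v => A v i j) s) :
    ContDiffOn 𝕜 n (fun v => (A v).det) s := by
  simp only [Matrix.det_apply']
  exact ContDiffOn.sum fun σ _ => contDiffOn_const.mul (contDiffOn_prod fun i _ => hA (σ i) i)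

theorem contDiffOn_inv_apply (hA : ∀ i j, ContDiffOn 𝕜 n (fun v => A v i j) s)
    (hdet : ∀ v ∈ s, IsUnit (A v)) (i j : ι) : ContDiffOn 𝕜 n (fun v => (A v)⁻¹ i j) s := by
  simp only [Matrix.inv_def, Ring.inverse_eq_inv', Matrix.smul_apply, smul_eq_mul,
    Matrix.adjugate_apply]
  refine ((contDiffOn_det hA).inv fun v hv =>
    ((Matrix.isUnit_iff_isUnit_det _).1 (hdet v hv)).ne_zero).mul (contDiffOn_det fun k l => ?_)
  rcases eq_or_ne k j with rfl | hkj
  · simp only [Matrix.updateRow_self]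
    exact contDiffOn_const
  · simp only [Matrix.updateRow_ne hkj]
    exact hA k l

end MatrixSmoothness

/-! ### The chain with frozen weights -/

section Trans

open scoped Matrix

variable {d : ℕ} {R : Matrix (Fin d) (Fin d) ℝ} {v : Fin d → ℝ}

/-- The transition matrix of the walk when the occupation vector is held fixed at `v`. -/
noncomputable def trans (R : Matrix (Fin d) (Fin d) ℝ) (v : Fin d → ℝ) :
    Matrix (Fin d) (Fin d) ℝ :=
  .of fun i j => R i j * v j / N R v i

theorem trans_mem_rowStochastic (hpos : ∀ i j, 0 < R i j) (hv : v ∈ stdSimplex ℝ (Fin d)) :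
    trans R v ∈ Matrix.rowStochastic ℝ (Fin d) := by
  refine Matrix.mem_rowStochastic_iff_sum.2 ⟨fun i j => ?_, fun i => ?_⟩
  · exact div_nonneg (mul_nonneg (hpos i j).le (hv.1 j)) (N_pos hpos hv i).le
  · simp only [trans, Matrix.of_apply, ← Finset.sum_div]
    exact div_self (N_pos hpos hv i).ne'

theorem sum_piVec (hH : H R v ≠ 0) : ∑ i, piVec R v i = 1 := by
  simp only [piVec, ← Finset.sum_div]
  exact div_self hH

theorem piVec_vecMul_trans (hsymm : R.IsSymm) (hN : ∀ i, N R v i ≠ 0) :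
    piVec R v ᵥ* trans R v = piVec R v := by
  ext j
  calc ∑ i, piVec R v i * trans R v i j = ∑ i, v j * (R j i * v i) / H R v :=
        Finset.sum_congr rfl fun i _ => by
          rw [piVec, trans, Matrix.of_apply, hsymm.apply]
          field [hN i]
    _ = piVec R v j := by rw [← Finset.sum_div, ← Finset.mul_sum, piVec, N]

theorem isUnit_one_sub_trans_add (hsymm : R.IsSymm) (hpos : ∀ i j, 0 < R i j)
    (hv : v ∈ stdSimplex ℝ (Fin d)) :
    IsUnit (1 - trans R v + Matrix.of fun _ => piVec R v) := by
  obtain ⟨j, hj⟩ := exists_pos_of_mem_stdSimplex hv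
  have hcol : ∀ i, 0 < trans R v i j := fun i =>
    div_pos (mul_pos (hpos i j) hj) (N_pos hpos hv i)
  exact isUnit_one_sub_add_of_stationary (piVec_vecMul_trans hsymm fun i => (N_pos hpos hv i).ne')
    (sum_piVec (H_pos hpos hv).ne') fun f hf =>
      eq_of_mulVec_eq_self (trans_mem_rowStochastic hpos hv) hcol hf

/-- The solution `g` of Poisson's equation `g - P g = f - π(f)` for the chain with the occupation
vector held fixed at `v`. -/
noncomputable def poissonSol (R : Matrix (Fin d) (Fin d) ℝ) (f v : Fin d → ℝ) : Fin d → ℝ :=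
  fundamentalMatrix (trans R v) (piVec R v) *ᵥ f

theorem poissonSol_sub_trans_mulVec (hsymm : R.IsSymm) (hpos : ∀ i j, 0 < R i j)
    (f : Fin d → ℝ) (hv : v ∈ stdSimplex ℝ (Fin d)) :
    poissonSol R f v - trans R v *ᵥ poissonSol R f v = f - fun _ => piVec R v ⬝ᵥ f :=
  sub_mulVec_fundamentalMatrix_mulVec (piVec_vecMul_trans hsymm fun i => (N_pos hpos hv i).ne')
    (sum_piVec (H_pos hpos hv).ne') (isUnit_one_sub_trans_add hsymm hpos hv) f

theorem contDiffOn_trans (hpos : ∀ i j, 0 < R i j) (i j : Fin d) :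
    ContDiffOn ℝ 1 (fun v => trans R v i j) (stdSimplex ℝ (Fin d)) := by
  have hN : ContDiff ℝ 1 fun v => N R v i := by
    unfold N
    fun_prop
  have hnum : ContDiff ℝ 1 fun v : Fin d → ℝ => R i j * v j := by fun_prop
  exact hnum.contDiffOn.div hN.contDiffOn fun v hv => (N_pos hpos hv i).ne'

theorem contDiffOn_poissonSol (hsymm : R.IsSymm) (hpos : ∀ i j, 0 < R i j) (f : Fin d → ℝ) :
    ContDiffOn ℝ 1 (poissonSol R f) (stdSimplex ℝ (Fin d)) := by
  have hentry : ∀ i j, ContDiffOn ℝ 1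
      (fun v => (1 - trans R v + Matrix.of fun _ => piVec R v : Matrix (Fin d) (Fin d) ℝ) i j)
      (stdSimplex ℝ (Fin d)) := fun i j => (contDiffOn_const.sub (contDiffOn_trans hpos i j)).add
      (contDiffOn_pi.1 (contDiffOn_piVec hpos) j)
  exact contDiffOn_pi.2 fun i => ContDiffOn.sum (s := Finset.univ) fun j _ =>
    (contDiffOn_inv_apply hentry (fun v => isUnit_one_sub_trans_add hsymm hpos) i j).mul
      contDiffOn_const

theorem contDiffOn_trans_mulVec_poissonSol (hsymm : R.IsSymm) (hpos : ∀ i j, 0 < R i j)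
    (f : Fin d → ℝ) :
    ContDiffOn ℝ 1 (fun v => trans R v *ᵥ poissonSol R f v) (stdSimplex ℝ (Fin d)) :=
  contDiffOn_pi.2 fun i => ContDiffOn.sum (s := Finset.univ) fun j _ =>
    (contDiffOn_trans hpos i j).mul (contDiffOn_pi.1 (contDiffOn_poissonSol hsymm hpos f) j)

end Trans

/-! ### Weighted sums along a slowly varying parameter -/

section SlowVariation

open scoped NNReal

/-- Summation by parts: up to the telescoping differences
`w (v k) (y k) - w (v (k + 1)) (y (k + 1))` the summands are controlled by the variation of the
parameter. -/
theorem exists_tendsto_sum_mul_sub_of_lipschitzOnWith {E ι : Type*} [PseudoMetricSpace E]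
    [Fintype ι] {K : ℝ≥0} {B C : ℝ} {s : Set E} {w : E → ι → ℝ} (hw : LipschitzOnWith K w s)
    (hB : ∀ v ∈ s, ‖w v‖ ≤ B) {γ : ℕ → ℝ} (hanti : Antitone γ) (hγ : Tendsto γ atTop (𝓝 0))
    (hsq : Summable fun n => γ n ^ 2) {v : ℕ → E} (hv : ∀ n, v n ∈ s)
    (hstep : ∀ n, dist (v (n + 1)) (v n) ≤ C * γ n) (y : ℕ → ι) :
    ∃ c, Tendsto (fun n => ∑ k ∈ Finset.range n, γ k * (w (v k) (y k) - w (v k) (y (k + 1))))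
      atTop (𝓝 c) := by
  have hγ0 : ∀ n, 0 ≤ γ n := hanti.le_of_tendsto hγ
  have htelescope : ∀ n, ‖∑ k ∈ Finset.range n, (w (v k) (y k) - w (v (k + 1)) (y (k + 1)))‖
      ≤ B + B := fun n => by
    rw [Finset.sum_range_sub' fun k => w (v k) (y k)]
    have hbound : ∀ k, ‖w (v k) (y k)‖ ≤ B := fun k => (norm_le_pi_norm _ _).trans (hB _ (hv k))
    exact (norm_sub_le _ _).trans (add_le_add (hbound 0) (hbound n))
  obtain ⟨c₁, hc₁⟩ := cauchySeq_tendsto_of_complete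
    (hanti.cauchySeq_series_mul_of_tendsto_zero_of_bounded hγ htelescope)
  have hvariation : Summable fun n => γ n * (w (v (n + 1)) (y (n + 1)) - w (v n) (y (n + 1))) := by
    refine .of_norm_bounded (hsq.mul_left (K * C)) fun n => ?_
    rw [norm_mul, Real.norm_of_nonneg (hγ0 n), ← dist_eq_norm, pow_two, mul_comm (γ n)]
    calc dist (w (v (n + 1)) (y (n + 1))) (w (v n) (y (n + 1))) * γ n
        ≤ K * (C * γ n) * γ n := mul_le_mul_of_nonneg_right ((dist_le_pi_dist _ _ _).trans
          ((hw.dist_le_mul _ (hv _) _ (hv n)).trans (by gcongr; exact hstep n))) (hγ0 n)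
      _ = K * C * (γ n * γ n) := by ring
  refine ⟨_, (hc₁.add hvariation.hasSum.tendsto_sum_nat).congr fun n => ?_⟩
  rw [← Finset.sum_add_distrib]
  exact Finset.sum_congr rfl fun k _ => by rw [smul_eq_mul]; ring

end SlowVariation

/-! ### Square summable martingale differences -/

section MartingaleDifferences

variable {Ω : Type*} {m₀ : MeasurableSpace Ω} {μ : Measure Ω}

theorem condExp_sub_eq_zero {m : MeasurableSpace Ω} (hm : m ≤ m₀) [SigmaFinite (μ.trim hm)]
    {f g : Ω → ℝ} (hf : Integrable f μ) (hg : StronglyMeasurable[m] g)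
    (hfg : μ[f | m] =ᵐ[μ] g) : μ[fun ω => f ω - g ω | m] =ᵐ[μ] 0 := by
  have hgint : Integrable g μ := integrable_condExp.congr hfg
  filter_upwards [condExp_sub hf hgint m, hfg] with ω hsub hω
  refine hsub.trans ?_
  rw [Pi.sub_apply, hω, condExp_of_stronglyMeasurable hm hg hgint, sub_self, Pi.zero_apply]

variable [IsFiniteMeasure μ]

theorem integral_mul_eq_zero_of_condExp_eq_zero {m : MeasurableSpace Ω} (hm : m ≤ m₀)
    {f g : Ω → ℝ} (hf : StronglyMeasurable[m] f) (hfL2 : MemLp f 2 μ) (hgL2 : MemLp g 2 μ)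
    (hg : μ[g | m] =ᵐ[μ] 0) : ∫ ω, f ω * g ω ∂μ = 0 := by
  have hpull : μ[f * g | m] =ᵐ[μ] f * μ[g | m] :=
    condExp_mul_of_stronglyMeasurable_left hf (hfL2.integrable_mul hgL2)
      (hgL2.integrable one_le_two)
  calc ∫ ω, f ω * g ω ∂μ = ∫ ω, (μ[f * g | m]) ω ∂μ := (integral_condExp hm).symm
    _ = ∫ _, 0 ∂μ := integral_congr_ae <| by
        filter_upwards [hpull, hg] with ω hω hω'
        rw [hω, Pi.mul_apply, hω', Pi.zero_apply, mul_zero]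
    _ = 0 := integral_zero _ _

variable {ℱ : Filtration ℕ m₀} {X : ℕ → Ω → ℝ}

theorem stronglyMeasurable_sum_range (hmeas : ∀ n, StronglyMeasurable[ℱ (n + 1)] (X n)) (n : ℕ) :
    StronglyMeasurable[ℱ n] fun ω => ∑ k ∈ Finset.range n, X k ω :=
  Finset.stronglyMeasurable_fun_sum _ fun k hk => (hmeas k).mono (ℱ.mono (Finset.mem_range.1 hk))

theorem integral_sq_sum_range_of_condExp_eq_zero
    (hmeas : ∀ n, StronglyMeasurable[ℱ (n + 1)] (X n)) (hL2 : ∀ n, MemLp (X n) 2 μ)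
    (hcond : ∀ n, μ[X n | ℱ n] =ᵐ[μ] 0) (n : ℕ) :
    ∫ ω, (∑ k ∈ Finset.range n, X k ω) ^ 2 ∂μ = ∑ k ∈ Finset.range n, ∫ ω, X k ω ^ 2 ∂μ := by
  induction n with
  | zero => simp
  | succ n ih =>
    have hsum : MemLp (fun ω => ∑ k ∈ Finset.range n, X k ω) 2 μ :=
      memLp_finsetSum _ fun k _ => hL2 k
    have hcross := integral_mul_eq_zero_of_condExp_eq_zero (ℱ.le n)
      (stronglyMeasurable_sum_range hmeas n) hsum (hL2 n) (hcond n)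
    have hintegrable : Integrable (fun ω => 2 * ((∑ k ∈ Finset.range n, X k ω) * X n ω)) μ :=
      (hsum.integrable_mul (hL2 n)).const_mul 2
    have hsquares : Integrable (fun ω => (∑ k ∈ Finset.range n, X k ω) ^ 2 + X n ω ^ 2) μ :=
      hsum.integrable_sq.add (hL2 n).integrable_sq
    simp only [Finset.sum_range_succ, add_sq', mul_assoc]
    rw [integral_add hsquares hintegrable, integral_add hsum.integrable_sq (hL2 n).integrable_sq,
      integral_const_mul, hcross, mul_zero, add_zero, ih]

theorem martingale_sum_range_of_condExp_eq_zero
    (hmeas : ∀ n, StronglyMeasurable[ℱ (n + 1)] (X n)) (hint : ∀ n, Integrable (X n) μ)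
    (hcond : ∀ n, μ[X n | ℱ n] =ᵐ[μ] 0) :
    Martingale (fun n ω => ∑ k ∈ Finset.range n, X k ω) ℱ μ := by
  refine martingale_of_condExp_sub_eq_zero_nat (stronglyMeasurable_sum_range hmeas)
    (fun n => integrable_finsetSum _ fun k _ => hint k) fun n => ?_
  have hincrement : (fun ω => ∑ k ∈ Finset.range (n + 1), X k ω) -
      (fun ω => ∑ k ∈ Finset.range n, X k ω) = X n := by
    ext ω
    rw [Pi.sub_apply, Finset.sum_range_succ, add_sub_cancel_left]
  rw [hincrement]
  exact hcond n

theorem ae_exists_tendsto_sum_range_of_condExp_eq_zero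
    (hmeas : ∀ n, StronglyMeasurable[ℱ (n + 1)] (X n)) (hL2 : ∀ n, MemLp (X n) 2 μ)
    (hcond : ∀ n, μ[X n | ℱ n] =ᵐ[μ] 0) (hsummable : Summable fun n => ∫ ω, X n ω ^ 2 ∂μ) :
    ∀ᵐ ω ∂μ, ∃ c, Tendsto (fun n => ∑ k ∈ Finset.range n, X k ω) atTop (𝓝 c) := by
  have hmart := martingale_sum_range_of_condExp_eq_zero hmeas
    (fun n => (hL2 n).integrable one_le_two) hcond
  refine hmart.submartingale.exists_ae_tendsto_of_bdd
    (R := (μ.real Set.univ + ∑' k, ∫ ω, X k ω ^ 2 ∂μ).toNNReal) fun n => ?_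
  have hsq : Integrable (fun ω => (∑ k ∈ Finset.range n, X k ω) ^ 2) μ :=
    (memLp_finsetSum _ fun k _ => hL2 k).integrable_sq
  rw [eLpNorm_one_eq_lintegral_enorm,
    ← ofReal_integral_norm_eq_lintegral_enorm (hmart.integrable n)]
  refine ENNReal.ofReal_le_ofReal ?_
  calc ∫ ω, ‖∑ k ∈ Finset.range n, X k ω‖ ∂μ
      ≤ ∫ ω, (1 + (∑ k ∈ Finset.range n, X k ω) ^ 2) ∂μ := by
        refine integral_mono (hmart.integrable n).norm ((integrable_const _).add hsq) fun ω => ?_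
        simp only [Real.norm_eq_abs]
        nlinarith [sq_abs (∑ k ∈ Finset.range n, X k ω),
          sq_nonneg (|∑ k ∈ Finset.range n, X k ω| - 1)]
    _ = μ.real Set.univ + ∑ k ∈ Finset.range n, ∫ ω, X k ω ^ 2 ∂μ := by
        rw [integral_add (integrable_const _) hsq, integral_const, smul_eq_mul, mul_one,
          integral_sq_sum_range_of_condExp_eq_zero hmeas hL2 hcond]
    _ ≤ μ.real Set.univ + ∑' k, ∫ ω, X k ω ^ 2 ∂μ := by
        gcongr
        exact hsummable.sum_le_tsum _ fun k _ => integral_nonneg fun ω => sq_nonneg _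

theorem ae_exists_tendsto_sum_range_mul_of_condExp_eq_zero {γ : ℕ → ℝ} {C : ℝ}
    (hmeas : ∀ n, StronglyMeasurable[ℱ (n + 1)] (X n)) (hbound : ∀ n ω, ‖X n ω‖ ≤ C)
    (hcond : ∀ n, μ[X n | ℱ n] =ᵐ[μ] 0) (hγ : Summable fun n => γ n ^ 2) :
    ∀ᵐ ω ∂μ, ∃ c, Tendsto (fun n => ∑ k ∈ Finset.range n, γ k * X k ω) atTop (𝓝 c) := by
  have hL2 : ∀ n, MemLp (X n) 2 μ := fun n =>
    .of_bound ((hmeas n).mono (ℱ.le _)).aestronglyMeasurable C (ae_of_all μ (hbound n))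
  refine ae_exists_tendsto_sum_range_of_condExp_eq_zero (fun n => (hmeas n).const_mul (γ n))
    (fun n => (hL2 n).const_mul (γ n)) (fun n => ?_) ?_
  · filter_upwards [condExp_smul (γ n) (X n) (ℱ n), hcond n] with ω hsmul hω
    exact hsmul.trans (by rw [Pi.smul_apply, hω, Pi.zero_apply, smul_zero])
  · refine .of_nonneg_of_le (fun n => integral_nonneg fun ω => sq_nonneg _) (fun n => ?_)
      (hγ.mul_right (C ^ 2 * μ.real Set.univ))
    calc ∫ ω, (γ n * X n ω) ^ 2 ∂μ ≤ ∫ _, γ n ^ 2 * C ^ 2 ∂μ :=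
          integral_mono ((hL2 n).const_mul (γ n)).integrable_sq (integrable_const _) fun ω => by
            rw [mul_pow]
            exact mul_le_mul_of_nonneg_left (sq_le_sq' (neg_le_of_abs_le (hbound n ω))
              (le_of_abs_le (hbound n ω))) (sq_nonneg _)
      _ = γ n ^ 2 * (C ^ 2 * μ.real Set.univ) := by
        rw [integral_const, smul_eq_mul]
        ring

end MartingaleDifferences

section History

variable {Ω ι β : Type*} [m₀ : MeasurableSpace Ω] [Finite ι] [TopologicalSpace ι]
  [TopologicalSpace.MetrizableSpace ι] [MeasurableSpace ι] [BorelSpace ι] [TopologicalSpace β]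

theorem stronglyMeasurable_natural_of_forall_eq {Y : ℕ → Ω → ι} (hY : ∀ n, StronglyMeasurable (Y n))
    {n : ℕ} {X : Ω → β} (hX : ∀ ω ω', (∀ k ≤ n, Y k ω = Y k ω') → X ω = X ω') :
    StronglyMeasurable[Filtration.natural Y hY n] X := by
  rcases isEmpty_or_nonempty Ω with hΩ | ⟨⟨ω₀⟩⟩
  · exact StronglyMeasurable.of_discrete
  let past : Ω → Set.Iic n → ι := fun ω k => Y k ω
  have hfactors : Function.FactorsThrough X past := fun ω ω' h =>
    hX ω ω' fun k hk => congrFun h ⟨k, hk⟩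
  rw [Filtration.natural_eq_comap,
    funext fun ω => (hfactors.extend_apply (fun _ => X ω₀) ω).symm]
  exact (StronglyMeasurable.of_discrete (f := Function.extend past X fun _ => X ω₀)).comp_measurable
    (comap_measurable past)

end History

/-! ### The occupation vector as a stochastic approximation -/

section Weights

variable {d : ℕ} {Ω : Type*} {a : Fin d → ℝ} {Y : ℕ → Ω → Fin d}

theorem S_pos (ha : ∀ i, 0 < a i) (n : ℕ) (ω : Ω) (i : Fin d) : 0 < S a Y n ω i := by
  induction n with
  | zero => exact ha i
  | succ n ih => exact add_pos_of_pos_of_nonneg ih (by split_ifs <;> norm_num)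

theorem sum_S (n : ℕ) (ω : Ω) : ∑ i, S a Y n ω i = ∑ i, a i + n := by
  induction n with
  | zero => simp [S]
  | succ n ih =>
    simp only [S, Finset.sum_add_distrib, ih, Finset.sum_ite_eq, Finset.mem_univ, if_true,
      Nat.cast_succ, add_assoc]

theorem sum_S_pos (ha : ∀ i, 0 < a i) (n : ℕ) (ω : Ω) : 0 < ∑ i, S a Y n ω i :=
  Finset.sum_pos (fun i _ => S_pos ha n ω i) ⟨Y 0 ω, Finset.mem_univ _⟩

theorem V_mem_stdSimplex (ha : ∀ i, 0 < a i) (n : ℕ) (ω : Ω) :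
    V a Y n ω ∈ stdSimplex ℝ (Fin d) := by
  refine ⟨fun i => div_nonneg (S_pos ha n ω i).le (sum_S_pos ha n ω).le, ?_⟩
  simp only [V, ← Finset.sum_div]
  exact div_self (sum_S_pos ha n ω).ne'

theorem S_congr {n : ℕ} {ω ω' : Ω} (h : ∀ k ≤ n, Y k ω = Y k ω') : S a Y n ω = S a Y n ω' := by
  induction n with
  | zero => rfl
  | succ n ih =>
    ext i
    rw [S, S, ih fun k hk => h k (hk.trans n.le_succ), h (n + 1) le_rfl]

theorem V_congr {n : ℕ} {ω ω' : Ω} (h : ∀ k ≤ n, Y k ω = Y k ω') : V a Y n ω = V a Y n ω' := by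
  ext i
  simp only [V, S_congr h]

/-- The step size `1 / ∑ i, S_i(n + 1)` with which the occupation vector is updated at time
`n + 1`. -/
noncomputable def stepSize (a : Fin d → ℝ) (n : ℕ) : ℝ := 1 / (n + (∑ i, a i + 1))

theorem stepSize_pos (ha : ∀ i, 0 < a i) (n : ℕ) : 0 < stepSize a n := by
  have hsum : 0 ≤ ∑ i, a i := Finset.sum_nonneg fun i _ => (ha i).le
  exact one_div_pos.2 (by positivity)

theorem antitone_stepSize (ha : ∀ i, 0 < a i) : Antitone (stepSize a) := fun m n hmn => by
  have hsum : 0 ≤ ∑ i, a i := Finset.sum_nonneg fun i _ => (ha i).le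
  exact one_div_le_one_div_of_le (by positivity) (by gcongr)

theorem tendsto_stepSize (a : Fin d → ℝ) : Tendsto (stepSize a) atTop (𝓝 0) :=
  tendsto_const_nhds.div_atTop
    (tendsto_atTop_add_const_right _ _ tendsto_natCast_atTop_atTop)

theorem summable_stepSize_sq (a : Fin d → ℝ) : Summable fun n => stepSize a n ^ 2 := by
  refine ((Real.summable_one_div_nat_add_rpow (∑ i, a i + 1) 2).2 one_lt_two).congr fun n => ?_
  rw [stepSize, div_pow, one_pow, Real.rpow_two, sq_abs]

theorem tendsto_sum_stepSize (ha : ∀ i, 0 < a i) :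
    Tendsto (fun n => ∑ k ∈ Finset.range n, stepSize a k) atTop atTop := by
  have hnot : ¬ Summable (stepSize a) := fun hsum =>
    lt_irrefl _ <| (Real.summable_one_div_nat_add_rpow (∑ i, a i + 1) 1).1 <|
      hsum.congr fun n => by
        rw [Real.rpow_one, abs_of_pos (one_div_pos.1 (stepSize_pos ha n)), stepSize]
  exact (not_summable_iff_tendsto_nat_atTop_of_nonneg fun n => (stepSize_pos ha n).le).1 hnot

theorem V_succ (ha : ∀ i, 0 < a i) (n : ℕ) (ω : Ω) :
    V a Y (n + 1) ω = V a Y n ω + stepSize a n • (Pi.single (Y (n + 1) ω) 1 - V a Y n ω) := by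
  have hn : 0 < ∑ i, a i + n := sum_S (Y := Y) n ω ▸ sum_S_pos ha n ω
  have hn_succ : ∑ i, a i + (n + 1 : ℕ) = ∑ i, a i + n + 1 := by rw [Nat.cast_succ, add_assoc]
  ext i
  simp only [Pi.add_apply, Pi.smul_apply, Pi.sub_apply, Pi.single_apply, smul_eq_mul, V, sum_S,
    stepSize, hn_succ, eq_comm (a := i), add_left_comm (n : ℝ), ← add_assoc]
  rw [S]
  field_simp
  ring

theorem dist_V_succ_le (ha : ∀ i, 0 < a i) (n : ℕ) (ω : Ω) :
    dist (V a Y (n + 1) ω) (V a Y n ω) ≤ stepSize a n := by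
  have hv := V_mem_stdSimplex (Y := Y) ha n ω
  have hsingle := single_mem_stdSimplex ℝ (Y (n + 1) ω)
  have hdist : dist (Pi.single (Y (n + 1) ω) 1) (V a Y n ω) ≤ 1 :=
    (dist_pi_le_iff zero_le_one).2 fun i => Real.dist_le_of_mem_Icc_01
      (mem_Icc_of_mem_stdSimplex hsingle i) (mem_Icc_of_mem_stdSimplex hv i)
  rw [V_succ ha, dist_self_add_left, norm_smul, Real.norm_of_nonneg (stepSize_pos ha n).le,
    ← dist_eq_norm]
  exact mul_le_of_le_one_right (stepSize_pos ha n).le hdist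

theorem transition_eq_trans (ha : ∀ i, 0 < a i) (R : Matrix (Fin d) (Fin d) ℝ) (n : ℕ) (ω : Ω)
    (i j : Fin d) :
    R i j * S a Y n ω j / ∑ k, R i k * S a Y n ω k = trans R (V a Y n ω) i j := by
  have hN : N R (V a Y n ω) i = (∑ k, R i k * S a Y n ω k) / ∑ k, S a Y n ω k := by
    simp only [N, V, Finset.sum_div, mul_div_assoc]
  rw [trans, Matrix.of_apply, hN, V, ← mul_div_assoc,
    div_div_div_cancel_right₀ (sum_S_pos ha n ω).ne']

end Weights

/-! ### Convergence of the walk -/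

section Walk

open scoped Matrix

variable {d : ℕ} {R : Matrix (Fin d) (Fin d) ℝ} {a : Fin d → ℝ} {y₀ : Fin d} {Ω : Type*}
  [MeasurableSpace Ω] {μ : Measure Ω} [IsFiniteMeasure μ] {Y : ℕ → Ω → Fin d}

theorem IsVRRW.condExp_eq_trans_mulVec (hY : IsVRRW μ R a y₀ Y) (ha : ∀ i, 0 < a i)
    {g : (Fin d → ℝ) → Fin d → ℝ} {C : ℝ} (hg : ∀ v ∈ stdSimplex ℝ (Fin d), ‖g v‖ ≤ C) (n : ℕ) :
    μ[fun ω => g (V a Y n ω) (Y (n + 1) ω) | history Y n] =ᵐ[μ]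
      fun ω => (trans R (V a Y n ω) *ᵥ g (V a Y n ω)) (Y n ω) := by
  let G : Fin d → Ω → ℝ := fun j ω => g (V a Y n ω) j
  let I : Fin d → Ω → ℝ := fun j => (Y (n + 1) ⁻¹' {j}).indicator fun _ => 1
  let ℱ := Filtration.natural Y fun n => (hY.measurable n).stronglyMeasurable
  have hG : ∀ j, StronglyMeasurable[ℱ n] (G j) := fun j =>
    stronglyMeasurable_natural_of_forall_eq _ fun ω ω' h => by simp only [G, V_congr h]
  have hI : ∀ j, Integrable (I j) μ := fun j =>
    (integrable_const 1).indicator (hY.measurable (n + 1) (.singleton j))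
  have hGI : ∀ j, Integrable (G j * I j) μ := fun j =>
    (hI j).bdd_mul ((hG j).mono (ℱ.le n)).aestronglyMeasurable <| ae_of_all _ fun ω =>
      (norm_le_pi_norm _ j).trans (hg _ (V_mem_stdSimplex ha n ω))
  have hdecompose : (fun ω => g (V a Y n ω) (Y (n + 1) ω)) = ∑ j, G j * I j := by
    ext ω
    rw [Finset.sum_apply, Finset.sum_eq_single (Y (n + 1) ω)]
    · simp [G, I]
    · exact fun j _ hj => by simp [I, hj.symm]
    · simp
  have hpull : ∀ j, μ[G j * I j | history Y n] =ᵐ[μ]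
      fun ω => trans R (V a Y n ω) (Y n ω) j * G j ω := fun j => by
    refine (condExp_mul_of_stronglyMeasurable_left (hG j) (hGI j) (hI j)).trans ?_
    filter_upwards [hY.transition n j] with ω hω
    rw [mul_comm, ← transition_eq_trans ha, ← hω]
    rfl
  rw [hdecompose]
  filter_upwards [condExp_finsetSum (fun j _ => hGI j) (history Y n), ae_all_iff.2 hpull]
    with ω hsum hω
  rw [hsum, Finset.sum_apply]
  exact Finset.sum_congr rfl fun j _ => hω j

theorem norm_trans_mulVec_le (hpos : ∀ i j, 0 < R i j) {v : Fin d → ℝ}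
    (hv : v ∈ stdSimplex ℝ (Fin d)) (f : Fin d → ℝ) : ‖trans R v *ᵥ f‖ ≤ ‖f‖ := by
  have hP := trans_mem_rowStochastic hpos hv
  refine (pi_norm_le_iff_of_nonneg (norm_nonneg f)).2 fun i => ?_
  calc ‖∑ j, trans R v i j * f j‖ ≤ ∑ j, trans R v i j * ‖f‖ :=
        norm_sum_le_of_le _ fun j _ => by
          rw [norm_mul, Real.norm_of_nonneg (Matrix.nonneg_of_mem_rowStochastic hP)]
          exact mul_le_mul_of_nonneg_left (norm_le_pi_norm f j)
            (Matrix.nonneg_of_mem_rowStochastic hP)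
    _ = ‖f‖ := by rw [← Finset.sum_mul, Matrix.sum_row_of_mem_rowStochastic hP, one_mul]

theorem IsVRRW.ae_exists_tendsto_sum_sub_trans_mulVec (hY : IsVRRW μ R a y₀ Y)
    (ha : ∀ i, 0 < a i) (hpos : ∀ i j, 0 < R i j) {g : (Fin d → ℝ) → Fin d → ℝ} {C : ℝ}
    (hg : ∀ v ∈ stdSimplex ℝ (Fin d), ‖g v‖ ≤ C) :
    ∀ᵐ ω ∂μ, ∃ c, Tendsto (fun n => ∑ k ∈ Finset.range n, stepSize a k *
      (g (V a Y k ω) (Y (k + 1) ω) - (trans R (V a Y k ω) *ᵥ g (V a Y k ω)) (Y k ω)))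
      atTop (𝓝 c) := by
  let ℱ := Filtration.natural Y fun n => (hY.measurable n).stronglyMeasurable
  let w : (Fin d → ℝ) → Fin d → ℝ := fun v => trans R v *ᵥ g v
  let D : ℕ → Ω → ℝ := fun n ω => g (V a Y n ω) (Y (n + 1) ω) - w (V a Y n ω) (Y n ω)
  have hgmeas : ∀ n, StronglyMeasurable[ℱ (n + 1)] fun ω => g (V a Y n ω) (Y (n + 1) ω) :=
    fun n => stronglyMeasurable_natural_of_forall_eq _ fun ω ω' h => by
      rw [V_congr fun k hk => h k (hk.trans n.le_succ), h (n + 1) le_rfl]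
  have hwmeas : ∀ n, StronglyMeasurable[ℱ n] fun ω => w (V a Y n ω) (Y n ω) :=
    fun n => stronglyMeasurable_natural_of_forall_eq _ fun ω ω' h => by
      rw [V_congr h, h n le_rfl]
  have hgbound : ∀ n ω i, ‖g (V a Y n ω) i‖ ≤ C := fun n ω i =>
    (norm_le_pi_norm _ i).trans (hg _ (V_mem_stdSimplex ha n ω))
  have hwbound : ∀ n ω i, ‖w (V a Y n ω) i‖ ≤ C := fun n ω i =>
    (norm_le_pi_norm _ i).trans <| (norm_trans_mulVec_le hpos (V_mem_stdSimplex ha n ω) _).trans <|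
      hg _ (V_mem_stdSimplex ha n ω)
  have hDmeas : ∀ n, StronglyMeasurable[ℱ (n + 1)] (D n) := fun n =>
    (hgmeas n).sub ((hwmeas n).mono (ℱ.mono n.le_succ))
  have hDbound : ∀ n ω, ‖D n ω‖ ≤ C + C := fun n ω =>
    norm_sub_le_of_le (hgbound n ω _) (hwbound n ω _)
  have hDcond : ∀ n, μ[D n | ℱ n] =ᵐ[μ] 0 := fun n =>
    condExp_sub_eq_zero (ℱ.le n) (.of_bound ((hgmeas n).mono (ℱ.le _)).aestronglyMeasurable C
      (ae_of_all μ fun ω => hgbound n ω _)) (hwmeas n) (hY.condExp_eq_trans_mulVec ha hg n)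
  exact ae_exists_tendsto_sum_range_mul_of_condExp_eq_zero hDmeas hDbound hDcond
    (summable_stepSize_sq a)

theorem IsVRRW.ae_exists_tendsto_sum_sub_piVec_dotProduct (hY : IsVRRW μ R a y₀ Y)
    (ha : ∀ i, 0 < a i) (hsymm : R.IsSymm) (hpos : ∀ i j, 0 < R i j) (f : Fin d → ℝ) :
    ∀ᵐ ω ∂μ, ∃ c, Tendsto (fun n => ∑ k ∈ Finset.range n, stepSize a k *
      (f (Y (k + 1) ω) - piVec R (V a Y k ω) ⬝ᵥ f)) atTop (𝓝 c) := by
  have hcompact := isCompact_stdSimplex ℝ (Fin d)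
  obtain ⟨C, hC⟩ := hcompact.exists_bound_of_continuousOn
    (contDiffOn_poissonSol hsymm hpos f).continuousOn
  obtain ⟨K, hK⟩ := (contDiffOn_trans_mulVec_poissonSol hsymm hpos f).exists_lipschitzOnWith
    one_ne_zero (convex_stdSimplex ℝ (Fin d)) hcompact
  filter_upwards [hY.ae_exists_tendsto_sum_sub_trans_mulVec ha hpos hC] with ω ⟨c₁, hc₁⟩
  obtain ⟨c₂, hc₂⟩ := exists_tendsto_sum_mul_sub_of_lipschitzOnWith hK
    (fun v hv => (norm_trans_mulVec_le hpos hv _).trans (hC v hv)) (antitone_stepSize ha)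
    (tendsto_stepSize a) (summable_stepSize_sq a) (V_mem_stdSimplex (Y := Y) ha · ω) (C := 1)
    (fun n => by simpa only [one_mul] using dist_V_succ_le ha n ω) fun n => Y n ω
  refine ⟨_, (hc₁.add hc₂).congr fun n => ?_⟩
  rw [← Finset.sum_add_distrib]
  refine Finset.sum_congr rfl fun k _ => ?_
  have hpoisson := congrFun (poissonSol_sub_trans_mulVec hsymm hpos f
    (V_mem_stdSimplex (Y := Y) ha k ω)) (Y (k + 1) ω)
  rw [← mul_add, sub_add_sub_cancel]
  exact congrArg _ hpoisson

theorem IsVRRW.ae_isRobbinsMonro (hY : IsVRRW μ R a y₀ Y) (ha : ∀ i, 0 < a i) (hsymm : R.IsSymm)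
    (hpos : ∀ i j, 0 < R i j) :
    ∀ᵐ ω ∂μ, IsRobbinsMonro (drift R) (stepSize a) fun n => V a Y n ω := by
  filter_upwards [ae_all_iff.2 fun i =>
    hY.ae_exists_tendsto_sum_sub_piVec_dotProduct ha hsymm hpos (Pi.single i 1)] with ω hω
  choose c hc using hω
  refine ⟨stepSize_pos ha, tendsto_stepSize a, tendsto_sum_stepSize ha, c,
    tendsto_pi_nhds.2 fun i => (hc i).congr fun n => ?_⟩
  rw [Finset.sum_apply]
  refine Finset.sum_congr rfl fun k _ => ?_
  rw [V_succ ha, dotProduct_single_one]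
  simp only [drift, Pi.sub_apply, Pi.add_apply, Pi.smul_apply, smul_eq_mul, Pi.single_apply,
    eq_comm (a := i)]
  ring

theorem IsVRRW.ae_mapClusterPt_mem_criticalSet (hY : IsVRRW μ R a y₀ Y) (ha : ∀ i, 0 < a i)
    (hsymm : R.IsSymm) (hpos : ∀ i j, 0 < R i j) :
    ∀ᵐ ω ∂μ, ∀ p, MapClusterPt p atTop (fun n => V a Y n ω) → p ∈ criticalSet R := by
  filter_upwards [hY.ae_isRobbinsMonro ha hsymm hpos] with ω hω p hp
  have hV := fun n => V_mem_stdSimplex (Y := Y) ha n ω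
  have hpsimplex : p ∈ stdSimplex ℝ (Fin d) :=
    (isClosed_stdSimplex ℝ (Fin d)).mem_of_mapClusterPt hp (.of_forall hV)
  refine mem_criticalSet_of_fderiv_H_drift_eq_zero hsymm hpos hpsimplex ?_
  exact hω.fderiv_apply_eq_zero_of_mapClusterPt (isCompact_stdSimplex ℝ (Fin d))
    (continuousOn_drift hpos) hV contDiff_H
    (fun v => fderiv_H_drift_nonneg hsymm hpos)
    ((finite_image_H_criticalSet hsymm).subset (Set.image_mono fun v hv =>
      mem_criticalSet_of_fderiv_H_drift_eq_zero hsymm hpos hv.1 hv.2)) hpsimplex hp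

theorem IsVRRW.ae_exists_tendsto_of_finite_criticalSet (hY : IsVRRW μ R a y₀ Y)
    (ha : ∀ i, 0 < a i) (hsymm : R.IsSymm) (hpos : ∀ i j, 0 < R i j)
    (hfin : (criticalSet R).Finite) :
    ∀ᵐ ω ∂μ, ∃ p ∈ criticalSet R, Tendsto (fun n => V a Y n ω) atTop (𝓝 p) := by
  filter_upwards [hY.ae_isRobbinsMonro ha hsymm hpos,
    hY.ae_mapClusterPt_mem_criticalSet ha hsymm hpos] with ω hrecursion hcluster
  have hcompact := isCompact_stdSimplex ℝ (Fin d)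
  have hV := fun n => V_mem_stdSimplex (Y := Y) ha n ω
  exact exists_tendsto_of_finite_mapClusterPt hcompact hfin hV
    (hrecursion.tendsto_dist_succ hcompact (continuousOn_drift hpos) hV) hcluster

end Walk

end VRRW

theorem mainTheorem5 {d : ℕ} (R : Matrix (Fin d) (Fin d) ℝ)
    (hsymm : R.IsSymm) (hnonneg : ∀ i j, 0 ≤ R i j) (hcol : ∀ j, 0 < ∑ i, R i j)
    (hoff : ∀ i j, i ≠ j → 0 < R i j)
    (hminors : ∀ s : Finset (Fin d), s.Nonempty →
      IsUnit (R.submatrix (fun i : s => (i : Fin d)) (fun i : s => (i : Fin d))))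
    (a : Fin d → ℝ) (ha : ∀ i, 0 < a i) (y₀ : Fin d)
    {Ω : Type*} [MeasurableSpace Ω] (μ : Measure Ω) [IsProbabilityMeasure μ]
    (Y : ℕ → Ω → Fin d) (hY : VRRW.IsVRRW μ R a y₀ Y) :
    (VRRW.criticalSet R).Finite ∧
      ∀ᵐ ω ∂μ, ∃ p ∈ VRRW.criticalSet R,
        Tendsto (fun n => VRRW.V a Y n ω) atTop (𝓝 p) := by
  have hfin := VRRW.finite_criticalSet hminors
  have hpos := VRRW.pos_of_isUnit_submatrix hnonneg hoff hminors
  exact ⟨hfin, hY.ae_exists_tendsto_of_finite_criticalSet ha hsymm hpos hfin⟩
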